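/- Let $n,k\ge 1$ be integers and let $s_1,\dots,s_k$ be integers with $1\le s_1<s_2<\dots<s_k\le \frac n2$. Let $C_n(s_1,\dots,s_k)$ be the circulant graph, i.e. the simple graph with vertex set $\{v_0,\dots,v_{n-1}\}$ and edge set $\{v_iv_{(i+s_j)\bmod n} : 0\le i\le n-1,\ 1\le j\le k\}$, and assume that it is connected. Let $K_2\vee C_n(s_1,\dots,s_k)$ be the join of $C_n(s_1,\dots,s_k)$ with the complete graph $K_2$, obtained from the disjoint union of the two graphs by adding all edges between a vertex of $K_2$ and a vertex of $C_n(s_1,\dots,s_k)$. Let $\tau(G)$ denote the number of spanning trees of a graph $G$, and let $\theta\in\mathbb C$ be a primitive $n$th root of unity. Then $$ \tau\bigl(K_2\vee C_n(s_1,\dots,s_k)\bigr)= \begin{cases} (n+2)\displaystyle\prod_{j=1}^{n-1}\Bigl(2k-\sum_{i=1}^{k}\theta^{s_ij}-\sum_{i=1}^{k}\theta^{-s_ij}+2\Bigr), & \text{if } s_k<\frac n2,\\[2ex] (n+2)\displaystyle\prod_{j=1}^{n-1}\Bigl(2k-\sum_{i=1}^{k}\theta^{s_ij}-\sum_{i=1}^{k-1}\theta^{-s_ij}+1\Bigr),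 & \text{if } s_k=\frac n2. \end{cases} $$ -/

import Mathlib

/-- The number of spanning trees of a graph on a finite vertex type. A spanning tree of `G` is a
tree on the whole vertex set of `G` all of whose edges are edges of `G`. -/
noncomputable def numSpanningTrees {V : Type*} (G : SimpleGraph V) : ℕ :=
  {T : SimpleGraph V | T ≤ G ∧ T.IsTree}.ncard

/-- The join of two (disjoint) graphs: their disjoint union together with all edges between a vertex
of the first and a vertex of the second. -/
def graphJoin {V W : Type*} (G : SimpleGraph V) (H : SimpleGraph W) : SimpleGraph (V ⊕ W) :=
  (G ⊕g H) ⊔ completeBipartiteGraph V W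

/-- The circulant graph `C_n(s_1, …, s_k)`: its vertices are the residues modulo `n`, and `u`, `v` are
adjacent when they are distinct and differ by some `± s_i` modulo `n`. -/
def circulantOf (n : ℕ) {k : ℕ} (s : Fin k → ℕ) : SimpleGraph (ZMod n) :=
  SimpleGraph.circulantGraph (Set.range fun i => (s i : ZMod n))

/-! Root the spanning trees at a vertex of `K₂`. Expanding the determinant of the rooted Laplacian
row by row gives one term for each choice `f` of a neighbour for every non-root vertex. The term is
1 if all orbits of `f` reach the root and 0 otherwise, and the `f` of the first kind are exactly the
spanning trees; this is `numSpanningTrees_eq_det`. For a join with `K₂`, let `L` be the Laplacian of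
the other factor. Since `L` kills constants, a column operation reduces the determinant to `(n + 2)
/ 2 * det (L + 2)`. For a circulant graph the characters of `ZMod n` diagonalise `L`, and the
trivial character contributes a factor 2, which cancels the denominator. -/

open Finset Matrix

/-! ### Spanning trees as parent functions. -/

/-- A parent function of a spanning tree of `G` rooted at `r`: every vertex other than `r` is sent to
a neighbour, and iterating leads from every vertex to `r`. -/
structure IsParentFunction {V : Type*} (G : SimpleGraph V) (r : V) (f : V → V) : Prop where
  map_root : f r = r
  adj : ∀ v, v ≠ r → G.Adj v (f v)
  reach : ∀ v, ∃ m : ℕ, f^[m] v = r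

/-- The graph with the edges `{v, f v}`. -/
def functionGraph {V : Type*} (f : V → V) : SimpleGraph V :=
  SimpleGraph.fromRel fun u v => f u = v

namespace IsParentFunction

variable {V : Type*} {G : SimpleGraph V} {r : V} {f g : V → V}

theorem apply_ne (hf : IsParentFunction G r f) {v : V} (hv : v ≠ r) : f v ≠ v :=
  (hf.adj v hv).ne'

/-- An orbit starting in `D` would never reach `r`. This serves as the induction principle for
parent functions, with `D` a set of counterexamples. -/
theorem notMem_of_mapsTo (hf : IsParentFunction G r f) {D : Set V} (hr : r ∉ D)
    (hD : ∀ v ∈ D, f v ∈ D) (v : V) : v ∉ D := by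
  intro hv
  obtain ⟨m, hm⟩ := hf.reach v
  have : ∀ m, f^[m] v ∈ D := by
    intro m
    induction m with
    | zero => exact hv
    | succ m ih => rw [Function.iterate_succ_apply']; exact hD _ ih
  exact hr (hm ▸ this m)

theorem functionGraph_adj (hf : IsParentFunction G r f) {v : V} (hv : v ≠ r) :
    (functionGraph f).Adj v (f v) := by
  simp [functionGraph, (hf.apply_ne hv).symm]

theorem functionGraph_le (hf : IsParentFunction G r f) : functionGraph f ≤ G := by
  intro u v huv
  simp only [functionGraph, SimpleGraph.fromRel_adj] at huv
  obtain ⟨hne, h | h⟩ := huv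
  · subst h
    refine hf.adj u fun hu => hne ?_
    rw [hu, hf.map_root]
  · subst h
    refine (hf.adj v fun hv => hne ?_).symm
    rw [hv, hf.map_root]

theorem reachable (hf : IsParentFunction G r f) (v : V) : (functionGraph f).Reachable v r := by
  by_contra hv
  refine hf.notMem_of_mapsTo (D := {v | ¬ (functionGraph f).Reachable v r}) (by simp) ?_ v hv
  intro w hw hfw
  have hwr : w ≠ r := by
    rintro rfl
    exact hw (SimpleGraph.Reachable.refl _)
  exact hw ((hf.functionGraph_adj hwr).reachable.trans hfw)

theorem functionGraph_connected (hf : IsParentFunction G r f) : (functionGraph f).Connected :=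
  haveI : Nonempty V := ⟨r⟩
  ⟨fun u v => (hf.reachable u).trans (hf.reachable v).symm⟩

theorem functionGraph_isTree [Fintype V] (hf : IsParentFunction G r f) :
    (functionGraph f).IsTree := by
  classical
  have hc := hf.functionGraph_connected
  have h1 := hc.card_vert_le_card_edgeSet_add_one
  refine SimpleGraph.isTree_iff_connected_and_card.2 ⟨hc, le_antisymm ?_ h1⟩
  -- Each edge comes from a non-root vertex, so there are at most `|V| - 1` edges.
  have hsub : (functionGraph f).edgeSet ⊆ (fun v => s(v, f v)) '' {v | v ≠ r} := by
    intro e he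
    induction e with
    | _ u v =>
    rw [SimpleGraph.mem_edgeSet] at he
    simp only [functionGraph, SimpleGraph.fromRel_adj] at he
    obtain ⟨hne, h | h⟩ := he
    · refine ⟨u, ?_, by simp [h]⟩
      rintro rfl
      exact hne (hf.map_root.symm.trans h)
    · refine ⟨v, ?_, by simp [h, Sym2.eq_swap]⟩
      rintro rfl
      exact hne (h.symm.trans hf.map_root)
  have h2 : (functionGraph f).edgeSet.ncard ≤ {v : V | v ≠ r}.ncard :=
    (Set.ncard_le_ncard hsub (Set.toFinite _)).trans (Set.ncard_image_le (Set.toFinite _))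
  have h3 : {v : V | v ≠ r}.ncard + 1 = Nat.card V := by
    have := Set.ncard_add_ncard_compl ({r} : Set V)
    rw [Set.ncard_singleton] at this
    rw [← this, add_comm]
    rfl
  rw [← h3, Nat.card_coe_set_eq]
  omega

theorem functionGraph_injective (hf : IsParentFunction G r f) (hg : IsParentFunction G r g)
    (h : functionGraph f = functionGraph g) : f = g := by
  funext v
  by_contra hv
  refine hg.notMem_of_mapsTo (D := {v | f v ≠ g v}) (by simp [hf.map_root, hg.map_root]) ?_ v hv
  intro w hw
  have hwr : w ≠ r := by
    rintro rfl
    exact hw (by rw [hf.map_root, hg.map_root])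
  have hadj := hg.functionGraph_adj hwr
  rw [← h] at hadj
  simp only [functionGraph, SimpleGraph.fromRel_adj] at hadj
  have hfg : f (g w) = w := hadj.2.resolve_left hw
  -- If `f` and `g` agreed at `g w`, then `g` would swap `w` and `g w`, a cycle that avoids the
  -- root.
  intro hgg
  rw [hfg] at hgg
  refine hg.notMem_of_mapsTo (D := {w, g w}) ?_ ?_ w (by simp)
  · rintro (h1 | h1)
    · exact hwr h1.symm
    · rw [Set.mem_singleton_iff] at h1
      rw [← h1, hf.map_root] at hfg
      exact hwr hfg.symm
  · rintro x (rfl | hx)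
    · simp
    · rw [Set.mem_singleton_iff] at hx
      subst hx
      simp [← hgg]

end IsParentFunction

/-- Send each vertex to a neighbour in `T` closer to `r`. The resulting tree lies in `T` and has as
many edges, hence equals `T`. -/
theorem SimpleGraph.IsTree.exists_parentFunction {V : Type*} [Fintype V] {G T : SimpleGraph V}
    (hT : T.IsTree) (hTG : T ≤ G) (r : V) : ∃ f, IsParentFunction G r f ∧ functionGraph f = T := by
  classical
  have key : ∀ v, v ≠ r → ∃ w, T.Adj v w ∧ T.dist w r < T.dist v r := by
    intro v hv
    obtain ⟨p, hp⟩ := (hT.connected v r).exists_walk_length_eq_dist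
    cases p with
    | nil => exact absurd rfl hv
    | cons h q =>
      refine ⟨_, h, ?_⟩
      rw [← hp, SimpleGraph.Walk.length_cons]
      exact Nat.lt_succ_of_le (SimpleGraph.dist_le q)
  choose p hp hd using key
  let f : V → V := fun v => if h : v = r then r else p v h
  have hf0 : ∀ v (h : v ≠ r), f v = p v h := fun v h => by simp [f, h]
  have hfT : IsParentFunction T r f := by
    refine ⟨by simp [f], fun v hv => by rw [hf0 v hv]; exact hp v hv, ?_⟩
    intro v
    induction hn : T.dist v r using Nat.strong_induction_on generalizing v with
    | _ n ih =>
    by_cases hv : v = r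
    · exact ⟨0, hv⟩
    · obtain ⟨m, hm⟩ := ih _ (hn ▸ hd v hv) (p v hv) rfl
      refine ⟨m + 1, ?_⟩
      rw [Function.iterate_succ_apply, hf0 v hv, hm]
  have hfG : IsParentFunction G r f := ⟨hfT.map_root, fun v hv => hTG (hfT.adj v hv), hfT.reach⟩
  refine ⟨f, hfG, ?_⟩
  have h1 := SimpleGraph.isTree_iff_connected_and_card.1 hfT.functionGraph_isTree
  have h2 := SimpleGraph.isTree_iff_connected_and_card.1 hT
  have hc : T.edgeSet.ncard ≤ (functionGraph f).edgeSet.ncard := by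
    have := h1.2
    have := h2.2
    rw [← Nat.card_coe_set_eq, ← Nat.card_coe_set_eq]
    omega
  exact SimpleGraph.edgeSet_injective <| Set.eq_of_subset_of_ncard_le
    (SimpleGraph.edgeSet_mono hfT.functionGraph_le) hc (Set.toFinite _)

theorem numSpanningTrees_eq_ncard_parentFunction {V : Type*} [Fintype V] (G : SimpleGraph V)
    (r : V) : numSpanningTrees G = {f | IsParentFunction G r f}.ncard := by
  symm
  refine Set.ncard_congr (fun f _ => functionGraph f) ?_ ?_ ?_
  · exact fun f hf => ⟨hf.functionGraph_le, hf.functionGraph_isTree⟩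
  · exact fun f g hf hg h => hf.functionGraph_injective hg h
  · rintro T ⟨hTG, hT⟩
    obtain ⟨f, hf, h⟩ := hT.exists_parentFunction hTG r
    exact ⟨f, hf, h⟩

/-! ### The matrix-tree theorem. -/

/-- The matrix whose row at `v` is `e_v - e_{f v}`, with row `e_r` at `r`. -/
def parentMatrix {V : Type*} [DecidableEq V] (r : V) (f : V → V) : Matrix V V ℂ :=
  fun v => if v = r then Pi.single r 1 else Pi.single v 1 - Pi.single (f v) 1

theorem parentMatrix_mulVec {V : Type*} [Fintype V] [DecidableEq V] (r : V) (f : V → V)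
    (x : V → ℂ) (v : V) : (parentMatrix r f *ᵥ x) v = if v = r then x r else x v - x (f v) := by
  rw [mulVec, parentMatrix]
  split_ifs
  · simp
  · change (Pi.single v 1 - Pi.single (f v) 1 : V → ℂ) ⬝ᵥ x = _
    simp [sub_dotProduct]

/-- The characteristic polynomial of `1 - M` is a power of `X`; evaluate it at 1. -/
theorem det_eq_one_of_isNilpotent_one_sub {V : Type*} [Fintype V] [DecidableEq V]
    {M : Matrix V V ℂ} (h : IsNilpotent (1 - M)) : M.det = 1 := by
  have h1 := (isNilpotent_charpoly_sub_pow_of_isNilpotent h).eq_zero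
  have h2 := congrArg (Polynomial.eval 1) (sub_eq_zero.1 h1)
  rw [eval_charpoly] at h2
  simpa using h2

/-- The difference `N` from the identity shifts along `f` and kills the value at the root, so a
power beyond the greatest depth vanishes. -/
theorem det_parentMatrix {V : Type*} [Fintype V] [DecidableEq V] {G : SimpleGraph V} {r : V}
    {f : V → V} (hf : IsParentFunction G r f) : (parentMatrix r f).det = 1 := by
  apply det_eq_one_of_isNilpotent_one_sub
  set N := 1 - parentMatrix r f with hN
  have happ : ∀ x v, (N *ᵥ x) v = if v = r then 0 else x (f v) := by
    intro x v
    rw [hN, sub_mulVec, one_mulVec, Pi.sub_apply, parentMatrix_mulVec]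
    split_ifs with h <;> simp [h]
  have hpow : ∀ m v x, f^[m] v = r → ((N ^ (m + 1)) *ᵥ x) v = 0 := by
    intro m
    induction m with
    | zero =>
      intro v x hv
      rw [zero_add, pow_one, happ]
      exact if_pos hv
    | succ m ih =>
      intro v x hv
      rw [pow_succ', ← mulVec_mulVec, happ]
      split_ifs
      · rfl
      · exact ih _ _ hv
  choose m hm using hf.reach
  have hfix : ∀ j, f^[j] r = r := fun j => Function.iterate_fixed hf.map_root j
  refine ⟨univ.sup m + 1, ?_⟩
  apply Matrix.ext_of_mulVec_single
  intro w
  funext v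
  rw [zero_mulVec, Pi.zero_apply]
  apply hpow
  have hle : m v ≤ univ.sup m := Finset.le_sup (mem_univ v)
  rw [← Nat.sub_add_cancel hle, Function.iterate_add_apply, hm, hfix]

theorem det_parentMatrix_eq_zero {V : Type*} [Fintype V] [DecidableEq V] {r : V}
    {f : V → V} (hr : f r = r) {v : V} (hv : ∀ m : ℕ, f^[m] v ≠ r) :
    (parentMatrix r f).det = 0 := by
  classical
  rw [← exists_mulVec_eq_zero_iff]
  -- The indicator of the vertices that never reach `r` is a kernel vector.
  refine ⟨fun w => if ∃ m : ℕ, f^[m] w = r then 0 else 1, ?_, ?_⟩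
  · intro h
    have := congrFun h v
    simp [hv] at this
  · funext w
    rw [parentMatrix_mulVec]
    split_ifs with h h1 h2 h3 h4
    · rfl
    · exact absurd ⟨0, rfl⟩ h1
    · simp
    · obtain ⟨m, hm⟩ := h2
      refine absurd ⟨m, ?_⟩ h3
      rw [← Function.iterate_succ_apply, Function.iterate_succ_apply', hm, hr]
    · obtain ⟨m, hm⟩ := h4
      exact absurd ⟨m + 1, hm⟩ h2
    · simp

/-- The Laplacian matrix of `G` with row `r` replaced by that of the identity matrix. -/
noncomputable def rootedLaplacian {V : Type*} [Fintype V] [DecidableEq V] (G : SimpleGraph V)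
    [DecidableRel G.Adj] (r : V) : Matrix V V ℂ :=
  fun v => if v = r then Pi.single r 1 else G.lapMatrix ℂ v

theorem SimpleGraph.lapMatrix_row {V : Type*} [Fintype V] [DecidableEq V] (G : SimpleGraph V)
    [DecidableRel G.Adj] (v : V) :
    G.lapMatrix ℂ v = ∑ w ∈ G.neighborFinset v, (Pi.single v 1 - Pi.single w 1 : V → ℂ) := by
  funext u
  rw [Finset.sum_apply]
  simp only [Pi.sub_apply, Finset.sum_sub_distrib, Finset.sum_const, card_neighborFinset_eq_degree,
    lapMatrix, degMatrix, Matrix.sub_apply, diagonal_apply, adjMatrix_apply, Pi.single_apply]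
  congr 1
  · by_cases h : v = u
    · simp [h]
    · simp [h, Ne.symm h]
  · simp

/-- The matrix-tree theorem. -/
theorem numSpanningTrees_eq_det {V : Type*} [Fintype V] [DecidableEq V] (G : SimpleGraph V)
    [DecidableRel G.Adj] (r : V) : (numSpanningTrees G : ℂ) = (rootedLaplacian G r).det := by
  classical
  let A : V → Finset V := fun v => if v = r then {r} else G.neighborFinset v
  let g : V → V → V → ℂ := fun v w =>
    if v = r then Pi.single r 1 else Pi.single v 1 - Pi.single w 1
  have hrow : rootedLaplacian G r = fun v => ∑ w ∈ A v, g v w := by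
    funext v
    by_cases h : v = r
    · simp [rootedLaplacian, A, g, h]
    · simp only [rootedLaplacian, A, g, h, if_false]
      exact G.lapMatrix_row v
  have hdet : (rootedLaplacian G r).det = ∑ f ∈ Fintype.piFinset A, (parentMatrix r f).det := by
    rw [hrow]
    exact (detRowAlternating (n := V) (R := ℂ)).toMultilinearMap.map_sum_finset g A
  have hmem : ∀ f, f ∈ Fintype.piFinset A ↔ f r = r ∧ ∀ v, v ≠ r → G.Adj v (f v) := by
    intro f
    rw [Fintype.mem_piFinset]
    constructor
    · intro h
      refine ⟨by simpa [A] using h r, fun v hv => by simpa [A, hv] using h v⟩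
    · rintro ⟨h1, h2⟩ v
      by_cases hv : v = r
      · simp [A, hv, h1]
      · simpa [A, hv] using h2 v hv
  have hval : ∀ f ∈ Fintype.piFinset A,
      (parentMatrix r f).det = if IsParentFunction G r f then 1 else 0 := by
    intro f hf
    rw [hmem] at hf
    split_ifs with h
    · exact det_parentMatrix h
    · have : ∃ v, ∀ m : ℕ, f^[m] v ≠ r := by
        by_contra! hc
        exact h ⟨hf.1, hf.2, hc⟩
      obtain ⟨v, hv⟩ := this
      exact det_parentMatrix_eq_zero hf.1 hv
  rw [hdet, Finset.sum_congr rfl hval, Finset.sum_boole,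
    numSpanningTrees_eq_ncard_parentFunction G r, Set.ncard_eq_toFinset_card']
  congr 2
  ext f
  rw [Set.mem_toFinset, Finset.mem_filter, hmem, Set.mem_ofPred_eq]
  exact ⟨fun h => ⟨⟨h.map_root, h.adj⟩, h⟩, fun h => h.2⟩

/-! ### Joins with `K₂`. -/

theorem graphJoin_adj_inl_inl {V W : Type*} {G : SimpleGraph V} {H : SimpleGraph W} {u v : V} :
    (graphJoin G H).Adj (.inl u) (.inl v) ↔ G.Adj u v := by
  simp [graphJoin]

theorem graphJoin_adj_inl_inr {V W : Type*} {G : SimpleGraph V} {H : SimpleGraph W} {u : V}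
    {w : W} : (graphJoin G H).Adj (.inl u) (.inr w) := by
  simp [graphJoin]

theorem graphJoin_adj_inr_inl {V W : Type*} {G : SimpleGraph V} {H : SimpleGraph W} {u : V}
    {w : W} : (graphJoin G H).Adj (.inr w) (.inl u) := by
  simp [graphJoin]

theorem graphJoin_adj_inr_inr {V W : Type*} {G : SimpleGraph V} {H : SimpleGraph W} {w x : W} :
    (graphJoin G H).Adj (.inr w) (.inr x) ↔ H.Adj w x := by
  simp [graphJoin]

theorem degree_graphJoin_inl {V W : Type*} [Fintype V] [Fintype W] {G : SimpleGraph V}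
    {H : SimpleGraph W} [DecidableRel G.Adj] [DecidableRel (graphJoin G H).Adj] (v : V) :
    (graphJoin G H).degree (.inl v) = G.degree v + Fintype.card W := by
  have h : ((graphJoin G H).degree (.inl v) : ℚ) = G.degree v + Fintype.card W := by
    rw [SimpleGraph.degree_eq_sum_if_adj, SimpleGraph.degree_eq_sum_if_adj, Fintype.sum_sum_type]
    simp only [graphJoin_adj_inl_inl, graphJoin_adj_inl_inr, if_true]
    simp
  exact_mod_cast h

theorem degree_graphJoin_inr {V W : Type*} [Fintype V] [Fintype W] {G : SimpleGraph V}
    {H : SimpleGraph W} [DecidableRel H.Adj] [DecidableRel (graphJoin G H).Adj] (w : W) :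
    (graphJoin G H).degree (.inr w) = H.degree w + Fintype.card V := by
  have h : ((graphJoin G H).degree (.inr w) : ℚ) = H.degree w + Fintype.card V := by
    rw [SimpleGraph.degree_eq_sum_if_adj, SimpleGraph.degree_eq_sum_if_adj, Fintype.sum_sum_type]
    simp only [graphJoin_adj_inr_inr, graphJoin_adj_inr_inl, if_true]
    simp [add_comm]
  exact_mod_cast h

theorem rootedLaplacian_join_completeGraph_two {W : Type*} [Fintype W] [DecidableEq W]
    (H : SimpleGraph W) [DecidableRel H.Adj]
    [DecidableRel (graphJoin (SimpleGraph.completeGraph (Fin 2)) H).Adj] :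
    rootedLaplacian (graphJoin (SimpleGraph.completeGraph (Fin 2)) H) (.inl 0) =
      fromBlocks !![1, 0; -1, (Fintype.card W : ℂ) + 1] (of fun i _ => if i = 0 then 0 else -1)
        (of fun _ _ => -1) (H.lapMatrix ℂ + 2) := by
  ext (i | v) (j | w)
  · fin_cases i <;> fin_cases j <;>
      simp [rootedLaplacian, SimpleGraph.lapMatrix, SimpleGraph.degMatrix,
        degree_graphJoin_inl, graphJoin_adj_inl_inl, add_comm]
  · fin_cases i <;>
      simp [rootedLaplacian, SimpleGraph.lapMatrix, SimpleGraph.degMatrix, graphJoin_adj_inl_inr]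
  · simp [rootedLaplacian, SimpleGraph.lapMatrix, SimpleGraph.degMatrix, graphJoin_adj_inr_inl]
  · by_cases h : v = w
    · subst h
      have h2 : (2 : Matrix W W ℂ) v v = 2 := by
        simp [← diagonal_ofNat]
      simp [rootedLaplacian, SimpleGraph.lapMatrix, SimpleGraph.degMatrix, degree_graphJoin_inr, h2]
    · have h2 : (2 : Matrix W W ℂ) v w = 0 := by
        simp [← diagonal_ofNat, h]
      simp [rootedLaplacian, SimpleGraph.lapMatrix, SimpleGraph.degMatrix, graphJoin_adj_inr_inr, h,
        h2]

theorem two_mul_numSpanningTrees_join_completeGraph_two {W : Type*} [Fintype W] [DecidableEq W]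
    (H : SimpleGraph W) [DecidableRel H.Adj] :
    2 * (numSpanningTrees (graphJoin (SimpleGraph.completeGraph (Fin 2)) H) : ℂ) =
      ((Fintype.card W : ℂ) + 2) * (H.lapMatrix ℂ + 2).det := by
  classical
  set D : Matrix W W ℂ := H.lapMatrix ℂ + 2 with hD
  set A : Matrix (Fin 2) (Fin 2) ℂ := !![1, 0; -1, (Fintype.card W : ℂ) + 1]
  set B : Matrix (Fin 2) W ℂ := of fun i _ => if i = 0 then 0 else -1
  set X : Matrix W (Fin 2) ℂ := of fun _ _ => 1 / 2
  -- As `L` kills constants, `L + 2` sends the constant `1 / 2` to 1, which clears the lower left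
  -- block.
  have hDX : (of fun _ _ => -1 : Matrix W (Fin 2) ℂ) + D * X = 0 := by
    ext v j
    have h1 : ∑ w, H.lapMatrix ℂ v w = 0 := by
      have := congrFun (H.lapMatrix_mulVec_const_eq_zero (R := ℂ)) v
      simpa [mulVec, dotProduct] using this
    have h2 : ∑ w, (2 : Matrix W W ℂ) v w = 2 := by
      simp [← diagonal_ofNat, diagonal_apply]
    simp only [Matrix.add_apply, Matrix.mul_apply, of_apply, X, ← Finset.sum_mul, hD,
      Finset.sum_add_distrib, h1, h2, Matrix.zero_apply]
    norm_num
  have hmul : fromBlocks A B (of fun _ _ => -1) D * fromBlocks 1 0 X 1 =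
      fromBlocks (A + B * X) B 0 D := by
    rw [fromBlocks_multiply, Matrix.mul_one, Matrix.mul_one, Matrix.mul_one,
      hDX]
    simp
  have hdet := congrArg det hmul
  rw [det_mul, det_fromBlocks_zero₁₂, det_fromBlocks_zero₂₁, det_one, det_one, mul_one, mul_one]
    at hdet
  have hAB : 2 * (A + B * X).det = (Fintype.card W : ℂ) + 2 := by
    rw [det_fin_two]
    simp [A, B, X, Matrix.mul_apply]
    ring
  rw [numSpanningTrees_eq_det _ (.inl 0), rootedLaplacian_join_completeGraph_two, hdet,
    ← mul_assoc, hAB]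

/-! ### Circulant graphs and characters of `ZMod n`. -/

theorem ZMod.prod_eq_prod_range {n : ℕ} [NeZero n] {M : Type*} [CommMonoid M] (g : ZMod n → M) :
    ∏ j, g j = ∏ j ∈ Finset.range n, g j := by
  refine Finset.prod_nbij' ZMod.val (fun j : ℕ => (j : ZMod n)) ?_ ?_ ?_ ?_ ?_
  · exact fun j _ => mem_range.2 (ZMod.val_lt j)
  · simp
  · simp
  · exact fun j hj => ZMod.val_cast_of_lt (mem_range.1 hj)
  · simp

/-- By orthogonality of characters, the matrix with inverse characters times this one is `n • 1`. -/
theorem det_fourierMatrix_ne_zero {n : ℕ} [NeZero n] {χ : AddChar (ZMod n) ℂ}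
    (hχ : χ.IsPrimitive) : (of fun a j => χ (a * j) : Matrix (ZMod n) (ZMod n) ℂ).det ≠ 0 := by
  intro h
  have hmul : (of fun a j => χ (-(a * j)) : Matrix (ZMod n) (ZMod n) ℂ) *
      (of fun a j => χ (a * j)) = (n : ℂ) • 1 := by
    ext a b
    have : ∀ j : ZMod n, χ (-(a * j)) * χ (j * b) = χ (j * (b - a)) := by
      intro j
      rw [← AddChar.map_add_eq_mul]
      congr 1
      ring
    simp only [Matrix.mul_apply, of_apply, this, AddChar.sum_mulShift _ hχ, sub_eq_zero,
      ZMod.card, Matrix.smul_apply, one_apply, smul_eq_mul]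
    by_cases hab : a = b
    · simp [hab]
    · simp [hab, Ne.symm hab]
  have hdet := congrArg det hmul
  rw [det_mul, h, mul_zero, det_smul, det_one, mul_one] at hdet
  exact pow_ne_zero _ (NeZero.ne (n : ℂ)) hdet.symm

/-- The eigenvalues of a translation-invariant Laplacian on `ZMod n` are given by characters. -/
theorem det_lapMatrix_add_two_of_translationInvariant {n : ℕ} [NeZero n] {χ : AddChar (ZMod n) ℂ}
    (hχ : χ.IsPrimitive) (H : SimpleGraph (ZMod n)) [DecidableRel H.Adj] (T : Finset (ZMod n))
    (hT : ∀ u v, H.Adj u v ↔ v - u ∈ T) :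
    (H.lapMatrix ℂ + 2).det = ∏ j, ((#T : ℂ) + 2 - ∑ d ∈ T, χ (d * j)) := by
  set F : Matrix (ZMod n) (ZMod n) ℂ := of fun a j => χ (a * j) with hF
  have hnb : ∀ a, H.neighborFinset a = T.map (addLeftEmbedding a) := by
    intro a
    ext v
    simp only [SimpleGraph.mem_neighborFinset, hT, mem_map, addLeftEmbedding_apply]
    constructor
    · exact fun h => ⟨_, h, add_sub_cancel _ _⟩
    · rintro ⟨d, hd, rfl⟩
      rwa [add_sub_cancel_left]
  have hmul : (H.lapMatrix ℂ + 2) * F =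
      F * diagonal fun j => (#T : ℂ) + 2 - ∑ d ∈ T, χ (d * j) := by
    ext a j
    have h1 : (H.lapMatrix ℂ * F) a j = #T * χ (a * j) - ∑ d ∈ T, χ ((a + d) * j) := by
      have h := H.lapMatrix_mulVec_apply a (fun b => F b j)
      rw [← SimpleGraph.card_neighborFinset_eq_degree, hnb, card_map, sum_map] at h
      exact h
    have h2 : ((2 : Matrix (ZMod n) (ZMod n) ℂ) * F) a j = 2 * χ (a * j) := by
      rw [two_mul, two_mul]
      rfl
    rw [Matrix.add_mul, Matrix.add_apply, h1, h2, mul_diagonal]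
    simp only [add_mul, AddChar.map_add_eq_mul, ← Finset.mul_sum, hF, of_apply]
    ring
  have hdet := congrArg det hmul
  rw [det_mul, det_mul, det_diagonal, mul_comm] at hdet
  exact mul_left_cancel₀ (det_fourierMatrix_ne_zero hχ) hdet

/-- The number of spanning trees of the join of `K₂` with a circulant graph. The set `E` consists of
the indices whose jumps are not involutions. -/
theorem numSpanningTrees_join_circulantOf {n k : ℕ} [NeZero n] {s : Fin k → ℕ}
    (hs : StrictMono s) (hs_pos : ∀ i, 1 ≤ s i) (hs_le : ∀ i, 2 * s i ≤ n) {θ : ℂ}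
    (hθ : IsPrimitiveRoot θ n) (E : Finset (Fin k)) (hE : ∀ i ∈ E, 2 * s i < n)
    (hE' : ∀ i ∉ E, 2 * s i = n) :
    (numSpanningTrees (graphJoin (SimpleGraph.completeGraph (Fin 2)) (circulantOf n s)) : ℂ) =
      ((n : ℂ) + 2) * ∏ j ∈ Finset.Ico 1 n,
        ((k : ℂ) + #E + 2 - ∑ i, θ ^ ((s i : ℤ) * (j : ℤ))
          - ∑ i ∈ E, θ ^ (-((s i : ℤ) * (j : ℤ)))) := by
  classical
  have hn : 0 < n := NeZero.pos n
  have hlt : ∀ i, s i < n := fun i => by have := hs_pos i; have := hs_le i; omega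
  have hinj : Function.Injective fun i => (s i : ZMod n) := by
    intro i j hij
    have := congrArg ZMod.val hij
    simp only [ZMod.val_cast_of_lt (hlt _)] at this
    exact hs.injective this
  have hinj' : Function.Injective fun i => -(s i : ZMod n) := neg_injective.comp hinj
  have hne0 : ∀ i, (s i : ZMod n) ≠ 0 := by
    intro i h
    rw [ZMod.natCast_eq_zero_iff] at h
    exact absurd (Nat.le_of_dvd (hs_pos i) h) (by have := hlt i; omega)
  have hneg : ∀ i ∉ E, -(s i : ZMod n) = s i := by
    intro i hi
    rw [neg_eq_iff_add_eq_zero, ← two_mul]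
    have := hE' i hi
    have h : ((2 * s i : ℕ) : ZMod n) = 0 := by rw [this, ZMod.natCast_self]
    exact_mod_cast h
  set T₁ : Finset (ZMod n) := univ.image fun i => (s i : ZMod n) with hT₁
  set T₂ : Finset (ZMod n) := E.image fun i => -(s i : ZMod n) with hT₂
  -- A common element would make `n` divide `s j + s i`, which lies strictly between 0 and `n` when
  -- `j ∈ E`.
  have hdisj : Disjoint T₁ T₂ := by
    rw [Finset.disjoint_left]
    intro x hx hx'
    obtain ⟨i, -, rfl⟩ := mem_image.1 hx
    obtain ⟨j, hj, h⟩ := mem_image.1 hx'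
    rw [neg_eq_iff_add_eq_zero] at h
    have h' : ((s j + s i : ℕ) : ZMod n) = 0 := by exact_mod_cast h
    rw [ZMod.natCast_eq_zero_iff] at h'
    have := hE j hj
    have := hs_le i
    have := hs_pos i
    exact absurd (Nat.le_of_dvd (by omega) h') (by omega)
  have hsum : ∀ g : ZMod n → ℂ,
      ∑ d ∈ T₁ ∪ T₂, g d = ∑ i, g (s i) + ∑ i ∈ E, g (-(s i : ZMod n)) := by
    intro g
    rw [sum_union hdisj, hT₁, hT₂, sum_image hinj.injOn, sum_image hinj'.injOn]
  have hcard : (#(T₁ ∪ T₂) : ℂ) = k + #E := by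
    rw [card_union_of_disjoint hdisj, hT₁, hT₂, card_image_of_injective _ hinj,
      card_image_of_injective _ hinj', card_univ, Fintype.card_fin]
    push_cast
    rfl
  have hadj : ∀ u v, (circulantOf n s).Adj u v ↔ v - u ∈ T₁ ∪ T₂ := by
    intro u v
    simp only [circulantOf, SimpleGraph.circulantGraph_adj, Set.mem_range, mem_union, hT₁, hT₂,
      mem_image, mem_univ, true_and]
    constructor
    · rintro ⟨-, ⟨i, hi⟩ | ⟨i, hi⟩⟩
      · by_cases hiE : i ∈ E
        · exact Or.inr ⟨i, hiE, by rw [hi, neg_sub]⟩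
        · exact Or.inl ⟨i, by rw [← hneg i hiE, hi, neg_sub]⟩
      · exact Or.inl ⟨i, hi⟩
    · rintro (⟨i, hi⟩ | ⟨i, -, hi⟩)
      · refine ⟨?_, Or.inr ⟨i, hi⟩⟩
        rintro rfl
        exact hne0 i (by rw [hi, sub_self])
      · refine ⟨?_, Or.inl ⟨i, by rw [← neg_sub, ← hi, neg_neg]⟩⟩
        rintro rfl
        rw [sub_self, neg_eq_zero] at hi
        exact hne0 i hi
  have hχ := AddChar.zmodChar_primitive_of_primitive_root n hθ
  have hdet := det_lapMatrix_add_two_of_translationInvariant hχ _ _ hadj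
  have htree := two_mul_numSpanningTrees_join_completeGraph_two (circulantOf n s)
  -- The factor at `j = 0` is split off; it equals 2 and cancels the 2 on the left.
  rw [hdet, ZMod.prod_eq_prod_range, Finset.range_eq_Ico, Finset.prod_eq_prod_Ico_succ_bot hn]
    at htree
  simp only [Nat.cast_zero, mul_zero, AddChar.map_zero_eq_one, sum_const, nsmul_eq_mul, mul_one,
    add_sub_cancel_left, ZMod.card, zero_add] at htree
  have hprod : ∀ j : ℕ, ∑ d ∈ T₁ ∪ T₂, AddChar.zmodChar n hθ.pow_eq_one (d * j) =
      ∑ i, θ ^ ((s i : ℤ) * (j : ℤ)) + ∑ i ∈ E, θ ^ (-((s i : ℤ) * (j : ℤ))) := by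
    intro j
    have hpow : ∀ i, AddChar.zmodChar n hθ.pow_eq_one (s i * j) = θ ^ ((s i : ℤ) * (j : ℤ)) := by
      intro i
      have h := AddChar.zmodChar_apply' hθ.pow_eq_one (s i * j)
      rw [Nat.cast_mul] at h
      rw [h, ← Nat.cast_mul, zpow_natCast]
    rw [hsum]
    simp only [neg_mul, AddChar.map_neg_eq_inv, hpow, _root_.zpow_neg]
  simp only [hprod, hcard, ← sub_sub] at htree
  refine mul_left_cancel₀ (two_ne_zero (α := ℂ)) ?_
  rw [htree]
  ring

theorem mainTheorem5 (n k : ℕ) (hk : 0 < k) (s : Fin k → ℕ) (hs : StrictMono s)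
    (hs_pos : ∀ i, 1 ≤ s i) (hs_le : ∀ i, 2 * s i ≤ n)
    (hconn : (circulantOf n s).Connected)
    (θ : ℂ) (hθ : IsPrimitiveRoot θ n)
    (last : Fin k) (hlast : (last : ℕ) = k - 1) :
    (2 * s last < n →
      (numSpanningTrees (graphJoin (SimpleGraph.completeGraph (Fin 2)) (circulantOf n s)) : ℂ) =
        ((n : ℂ) + 2) * ∏ j ∈ Finset.Ico 1 n,
          (2 * (k : ℂ) - ∑ i, θ ^ ((s i : ℤ) * (j : ℤ))
            - ∑ i, θ ^ (-((s i : ℤ) * (j : ℤ))) + 2)) ∧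
    (2 * s last = n →
      (numSpanningTrees (graphJoin (SimpleGraph.completeGraph (Fin 2)) (circulantOf n s)) : ℂ) =
        ((n : ℂ) + 2) * ∏ j ∈ Finset.Ico 1 n,
          (2 * (k : ℂ) - ∑ i, θ ^ ((s i : ℤ) * (j : ℤ))
            - ∑ i ∈ Finset.univ.erase last, θ ^ (-((s i : ℤ) * (j : ℤ))) + 1)) := by
  have hn : NeZero n := ⟨by have := hs_pos last; have := hs_le last; omega⟩
  have hle : ∀ i, i ≤ last := fun i => Fin.le_def.2 (by omega)
  constructor
  · intro h
    rw [numSpanningTrees_join_circulantOf hs hs_pos hs_le hθ univ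
      (fun i _ => by have := hs.monotone (hle i); omega) (by simp)]
    congr 1
    refine prod_congr rfl fun j _ => ?_
    rw [card_univ, Fintype.card_fin]
    ring
  · intro h
    -- Only the largest jump is an involution, so the degree is `2 * k - 1` and the constant drops
    -- from 2 to 1.
    rw [numSpanningTrees_join_circulantOf hs hs_pos hs_le hθ (univ.erase last)
      (fun i hi => by have := hs ((hle i).lt_of_ne (ne_of_mem_erase hi)); omega) (by simpa using h)]
    congr 1
    refine prod_congr rfl fun j _ => ?_
    rw [card_erase_of_mem (mem_univ _), card_univ, Fintype.card_fin, Nat.cast_sub hk, Nat.cast_one]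
    ring
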